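/- Let $\psi=\sum_{i,j,k,l=0}^1\psi^{ijkl}|ijkl\rangle\in(\mathbb C^2)^{\otimes4}$ be a normalized four-qubit state vector that is antisymmetric in the two pairs of indices, $\psi^{ijkl}=-\psi^{klij}$. These vectors are exactly $$\psi^{ijkl}=\tfrac12\bigl(\varepsilon^{ik}A^{jl}+B^{ik}\varepsilon^{jl}\bigr),\qquad \varepsilon=\begin{pmatrix}0&1\\-1&0\end{pmatrix},\quad A=\begin{pmatrix}z_1-iz_2&-z_3\\-z_3&-z_1-iz_2\end{pmatrix},\quad B=\begin{pmatrix}w_1-iw_2&-w_3\\-w_3&-w_1-iw_2\end{pmatrix},$$ with $w,z\in\mathbb C^3$ satisfying $\|w\|^2+\|z\|^2=1$, and $w,z$ are uniquely determined by $\psi$. Let $\varrho=\pi_{12}=\operatorname{tr}_{34}|\psi\rangle\langle\psi|$ be the reduced state of the first two qubits. Put $$x=i\,w\times\bar w,\quad y=i\,z\times\bar z\ \in\mathbb R^3,\qquad r=\|x\|,\quad s=\|y\|,\quad \gamma_\pm=r\pm s,\qquad \eta=|w^2-z^2|,$$ where $u^2=u_1^2+u_2^2+u_3^2$ for $u\in\mathbb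 C^3$. Let $t^+=\max\{0,t\}$. Then $1-\eta^2-\gamma_-^2\ge0$, $1-\gamma_+^2\ge0$, and the Wootters concurrence of $\varrho$ is $$c(\varrho)=\tfrac12\Bigl(\sqrt{1-\eta^2-\gamma_-^2}-\sqrt{1-\gamma_+^2}\Bigr)^+ .$$ Here the Wootters concurrence is $(\lambda_1-\lambda_2-\lambda_3-\lambda_4)^+$, where $\lambda_1\ge\lambda_2\ge\lambda_3\ge\lambda_4$ are the eigenvalues of $\sqrt{\sqrt\varrho\,\tilde\varrho\,\sqrt\varrho}$ and $\tilde\varrho=\overline{(\varepsilon\otimes\varepsilon)\varrho(\varepsilon\otimes\varepsilon)^\dagger}$; the same number is the convex roof of the pure-state concurrence, that is, the minimum of $\sum_jp_j\,c(\varphi_j)$ over all finite decompositions $\varrho=\sum_jp_j|\varphi_j\rangle\langle\varphi_j|$ with $p_j\ge0$, $\sum_jp_j=1$, $\|\varphi_j\|=1$, where $c(\varphi)=\sqrt{2(1-\operatorname{tr}\pi_1^2)}$ and $\pi_1=\operatorname{tr}_2|\varphi\rangle\langle\varphi|$. Moreover, $\varrho$ is separable, i.e. $\varrho=\sum_jp_j\,\varrho_{1,j}\otimes\varrho_{2,j}$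 is a finite convex combination of tensor products of one-qubit density matrices, if and only if $\eta^2\ge4rs$. -/

import Mathlib

open scoped ComplexOrder MatrixOrder Kronecker

noncomputable section

namespace TwoQubit

/-- The index set of the computational basis of two qubits. -/
abbrev Ix : Type := Fin 2 × Fin 2

/-- State vectors of two qubits, with the Euclidean norm. -/
abbrev Vec2 : Type := EuclideanSpace ℂ Ix

/-- State vectors of four qubits, with the Euclidean norm; the amplitude `ψ^{ijkl}` is
`ψ ((i, j), (k, l))`. -/
abbrev Vec4 : Type := EuclideanSpace ℂ (Ix × Ix)

/-- The rank one operator `|ψ⟩⟨ψ|`. -/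
def ketbra {n : Type*} [Fintype n] (ψ : EuclideanSpace ℂ n) : Matrix n n ℂ :=
  fun p q => ψ p * star (ψ q)

/-- Partial trace over the second tensor factor. -/
def traceSnd {m n : Type*} [Fintype n] (M : Matrix (m × n) (m × n) ℂ) : Matrix m m ℂ :=
  fun p q => ∑ t, M (p, t) (q, t)

/-- Density matrices: positive semidefinite of unit trace. -/
def IsDensity {n : Type*} [Fintype n] (M : Matrix n n ℂ) : Prop :=
  M.PosSemidef ∧ M.trace = 1

/-- Separable two-qubit states: finite convex combinations of tensor products of states. -/
def IsSeparable (M : Matrix Ix Ix ℂ) : Prop :=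
  ∃ (m : ℕ) (p : Fin m → ℝ) (a b : Fin m → Matrix (Fin 2) (Fin 2) ℂ),
    (∀ j, 0 ≤ p j) ∧ ∑ j, p j = 1 ∧ (∀ j, IsDensity (a j)) ∧ (∀ j, IsDensity (b j)) ∧
      M = ∑ j, (p j : ℂ) • (a j ⊗ₖ b j)

/-- The antisymmetric `2 × 2` matrix `ε`. -/
def eps : Matrix (Fin 2) (Fin 2) ℂ := !![0, 1; -1, 0]

/-- The spin flip: the entrywise complex conjugate of `(ε ⊗ ε) ρ (ε ⊗ ε)†`. -/
def spinFlip (M : Matrix Ix Ix ℂ) : Matrix Ix Ix ℂ :=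
  ((eps ⊗ₖ eps) * M * (eps ⊗ₖ eps).conjTranspose).map star

/-- The positive semidefinite matrix `√(√ρ ρ̃ √ρ)`, for a density matrix `ρ`. -/
def woottersMatrix (M : Matrix Ix Ix ℂ) : Matrix Ix Ix ℂ :=
  CFC.sqrt (CFC.sqrt M * spinFlip M * CFC.sqrt M)

theorem woottersMatrix_isHermitian (M : Matrix Ix Ix ℂ) : (woottersMatrix M).IsHermitian :=
  (Matrix.nonneg_iff_posSemidef.mp (CFC.sqrt_nonneg _)).isHermitian

/-- The eigenvalues of `√(√ρ ρ̃ √ρ)` with multiplicity, in decreasing order. -/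
def woottersEigenvalue (M : Matrix Ix Ix ℂ) (k : Fin 4) : ℝ :=
  (woottersMatrix_isHermitian M).eigenvalues₀ (Fin.cast (by simp) k)

/-- The Wootters concurrence `(λ₁ - λ₂ - λ₃ - λ₄)⁺`. -/
def woottersConcurrence (M : Matrix Ix Ix ℂ) : ℝ :=
  max 0 (woottersEigenvalue M 0 - woottersEigenvalue M 1 - woottersEigenvalue M 2
    - woottersEigenvalue M 3)

/-- The concurrence of a pure two-qubit state: `C(π₁)` for the reduced state `π₁`, where
`C² = (d / (d - 1)) (1 - tr π₁²)` with `d = 2`. -/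
def pureConcurrence (φ : Vec2) : ℝ :=
  √(2 * (1 - (traceSnd (ketbra φ) * traceSnd (ketbra φ)).trace.re))

/-- The average concurrences of the pure state decompositions of `ρ`; the convex roof extension of
the pure state concurrence is the minimum of this set. -/
def averageConcurrences (M : Matrix Ix Ix ℂ) : Set ℝ :=
  {c | ∃ (m : ℕ) (p : Fin m → ℝ) (φ : Fin m → Vec2),
    (∀ j, 0 ≤ p j) ∧ ∑ j, p j = 1 ∧ (∀ j, ‖φ j‖ = 1) ∧
      M = ∑ j, (p j : ℂ) • ketbra (φ j) ∧ c = ∑ j, p j * pureConcurrence (φ j)}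

/-- Antisymmetry of a four-qubit vector in the two pairs of indices: `ψ^{ijkl} = -ψ^{klij}`. -/
def IsAntisymm (ψ : Vec4) : Prop :=
  ∀ i j k l : Fin 2, ψ ((i, j), (k, l)) = -ψ ((k, l), (i, j))

/-- The symmetric matrix with parameter `u ∈ ℂ³`; it is `A` for `u = z` and `B` for `u = w`. -/
def symMatrix (u : EuclideanSpace ℂ (Fin 3)) : Matrix (Fin 2) (Fin 2) ℂ :=
  !![u 0 - Complex.I * u 1, -u 2; -u 2, -u 0 - Complex.I * u 1]

/-- The four-qubit vector `ψ^{ijkl} = (ε^{ik} A^{jl} + B^{ik} ε^{jl}) / 2`. -/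
def paramVec (w z : EuclideanSpace ℂ (Fin 3)) : Vec4 :=
  WithLp.toLp 2 fun t =>
    (eps t.1.1 t.2.1 * symMatrix z t.1.2 t.2.2 + symMatrix w t.1.1 t.2.1 * eps t.1.2 t.2.2) / 2

/-- The two-qubit state `ϱ = π₁₂ = tr₃₄ |ψ⟩⟨ψ|`. -/
def reduced12 (ψ : Vec4) : Matrix Ix Ix ℂ := traceSnd (ketbra ψ)

/-- The bilinear square `u² = u₁² + u₂² + u₃²`. -/
def bilinSq (u : EuclideanSpace ℂ (Fin 3)) : ℂ := ∑ a, u a ^ 2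

/-- `η = |w² - z²|`. -/
def eta (w z : EuclideanSpace ℂ (Fin 3)) : ℝ := ‖bilinSq w - bilinSq z‖

/-- The vector `i u × ū`, whose coordinates are real; it is `x` for `u = w` and `y` for `u = z`. -/
def crossVec (u : EuclideanSpace ℂ (Fin 3)) : EuclideanSpace ℂ (Fin 3) :=
  WithLp.toLp 2 (Complex.I • crossProduct (fun a => u a) (fun a => star (u a)))

/-- `γ₊ = r + s` with `r = ‖x‖` and `s = ‖y‖`. -/
def gammaPlus (w z : EuclideanSpace ℂ (Fin 3)) : ℝ := ‖crossVec w‖ + ‖crossVec z‖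

/-- `γ₋ = r - s` with `r = ‖x‖` and `s = ‖y‖`. -/
def gammaMinus (w z : EuclideanSpace ℂ (Fin 3)) : ℝ := ‖crossVec w‖ - ‖crossVec z‖

/-- `(√(1 - η² - γ₋²) - √(1 - γ₊²))⁺ / 2`. -/
def concurrenceFormula (w z : EuclideanSpace ℂ (Fin 3)) : ℝ :=
  1 / 2 * max 0 (√(1 - eta w z ^ 2 - gammaMinus w z ^ 2) - √(1 - gammaPlus w z ^ 2))

end TwoQubit

end

/-!
The concurrence and the separability of a two-qubit state `ρ` are both governed by the quadratic
form `f ↦ fᵀ (ε ⊗ ε) f` (`flipValue`): on normalized vectors its modulus is the pure state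
concurrence (`pureConcurrence_eq`), and it vanishes exactly on product vectors.

*Convex roof.* Takagi factorization (`exists_takagi`) of the symmetric matrix `√ρᵀ (ε ⊗ ε) √ρ`
yields `ρ = G Gᴴ` with four columns that are orthogonal for the form, with values
`λ₁ ≥ λ₂ ≥ λ₃ ≥ λ₄ ≥ 0` (`exists_flip_orthogonal`). Since `ρ ρ̃` then has the characteristic
polynomial of `diag(λₖ²)`, these are the Wootters eigenvalues (`woottersEigenvalue_eq`). Any other
decomposition expresses its vectors through `G` with coefficient rows of norm one, so the triangle
inequality gives `λ₁ - λ₂ - λ₃ - λ₄` as a lower bound (`le_sum_norm_flipValue`). Conversely, after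
multiplying the columns by phases, mixing them with a Hadamard matrix gives four vectors of equal
flip value, and the phases can be chosen so that the total is `(λ₁ - λ₂ - λ₃ - λ₄)⁺`, by closing a
polygon with sides `λₖ` when possible (`exists_sum_norm_flipValue_eq`). Hence the roof is the
Wootters concurrence, and a state is separable if and only if it vanishes (`isSeparable_iff`).

*The antisymmetric family.* The vector with parameters `w, z`, read as a `4 × 4` matrix, is
`(ε ⊗ ε) N` with `N = (W ⊗ 1 + 1 ⊗ Z) / 2` and `W`, `Z` the transposes of `w · σ`, `z · σ`. Antisymmetry
makes the Wootters eigenvalues the singular values of `N²`. A local change of basis puts `W` and `Z`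
into off-diagonal form with entries `a, b` and `c, d`, where `a b = w²`, `|a|² + |b|² = 2 ‖w‖²`,
`|a|² - |b|² = 2 r`, and likewise for `z` (`exists_pauli_normalForm`). Then `N²` splits into two
`2 × 2` blocks (`charpoly_offDiagonal`), each with `η² / 16` as the product of its singular values. In
one block their difference is `√(1 - η² - γ₋²) / 2`, in the other their sum is `√(1 - γ₊²) / 2`, and
the pair of the first block encloses that of the second.
-/

noncomputable section

namespace TwoQubit

open Matrix

/-! ### Takagi factorization -/

section Takagi

variable {E : Type*} [NormedAddCommGroup E] [InnerProductSpace ℂ E]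

/-- A symmetric antilinear operator has a unit vector that it scales by a nonnegative real. If `v`
is an eigenvector of the square for the eigenvalue `l ^ 2`, then `T v + l v` is fixed up to the
factor `l`, and where it vanishes `i v` serves. -/
theorem exists_unit_coneigenvector [FiniteDimensional ℂ E] [Nontrivial E] (T : E →ₗ⋆[ℂ] E)
    (hT : ∀ u v, inner ℂ (T u) v = inner ℂ (T v) u) :
    ∃ (v : E) (l : ℝ), ‖v‖ = 1 ∧ 0 ≤ l ∧ T v = (l : ℂ) • v := by
  suffices h : ∃ (v : E) (l : ℝ), v ≠ 0 ∧ 0 ≤ l ∧ T v = (l : ℂ) • v by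
    obtain ⟨v, l, hv, hl, h⟩ := h
    refine ⟨((‖v‖⁻¹ : ℝ) : ℂ) • v, l, ?_, hl, ?_⟩
    · rw [norm_smul]
      simp [hv]
    · rw [LinearMap.map_smulₛₗ, h, Complex.conj_ofReal, smul_comm]
  obtain ⟨m, hm⟩ := Module.End.exists_eigenvalue (T.comp T : E →ₗ[ℂ] E)
  obtain ⟨v, hv⟩ := hm.exists_hasEigenvector
  have hv0 : v ≠ 0 := hv.2
  have hTT : T (T v) = m • v := hv.apply_eq_smul
  have h1 : inner ℂ (T v) (T v) = m * inner ℂ v v := by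
    rw [← inner_conj_symm (T v) (T v), hT v (T v), hTT, inner_smul_left, map_mul,
      Complex.conj_conj, inner_conj_symm]
  have h1' : ((‖T v‖ ^ 2 : ℝ) : ℂ) = m * ((‖v‖ ^ 2 : ℝ) : ℂ) := by
    simpa [inner_self_eq_norm_sq_to_K] using h1
  obtain ⟨l, hl, hml⟩ : ∃ l : ℝ, 0 ≤ l ∧ m = (l : ℂ) ^ 2 := by
    refine ⟨‖T v‖ / ‖v‖, by positivity, ?_⟩
    have : (‖v‖ : ℂ) ≠ 0 := by simpa using hv0
    push_cast at h1' ⊢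
    field_simp
    rw [h1']
  by_cases h0 : T v + (l : ℂ) • v = 0
  · refine ⟨Complex.I • v, l, smul_ne_zero Complex.I_ne_zero hv0, hl, ?_⟩
    rw [LinearMap.map_smulₛₗ, eq_neg_of_add_eq_zero_left h0]
    simp only [Complex.conj_I, smul_neg, neg_smul, neg_neg]
    exact smul_comm _ _ _
  · refine ⟨_, l, h0, hl, ?_⟩
    rw [map_add, hTT, LinearMap.map_smulₛₗ, hml, Complex.conj_ofReal, smul_add, smul_smul, sq,
      add_comm]

/-- A symmetric antilinear operator on a complex inner product space of dimension `n` has `n`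
orthonormal vectors that it scales by nonnegative reals. -/
theorem exists_orthonormal_coneigenvectors (n : ℕ) :
    ∀ {E : Type*} [NormedAddCommGroup E] [InnerProductSpace ℂ E] [FiniteDimensional ℂ E]
      (_ : Module.finrank ℂ E = n) (T : E →ₗ⋆[ℂ] E)
      (_ : ∀ u v, inner ℂ (T u) v = inner ℂ (T v) u),
      ∃ (b : Fin n → E) (l : Fin n → ℝ), Orthonormal ℂ b ∧ (∀ k, 0 ≤ l k) ∧
        ∀ k, T (b k) = (l k : ℂ) • b k := by
  induction n with
  | zero =>
    intro E _ _ _ _ T _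
    exact ⟨Fin.elim0, Fin.elim0, ⟨fun k => k.elim0, fun k => k.elim0⟩, fun k => k.elim0,
      fun k => k.elim0⟩
  | succ n ih =>
    intro E _ _ _ hn T hT
    have : Nontrivial E := Module.nontrivial_of_finrank_pos (R := ℂ) (by omega)
    obtain ⟨v, l, hv, hl, hTv⟩ := exists_unit_coneigenvector T hT
    have hv0 : v ≠ 0 := by
      rintro rfl
      simp at hv
    have hinv : ∀ u ∈ (ℂ ∙ v)ᗮ, T u ∈ (ℂ ∙ v)ᗮ := by
      intro u hu
      rw [Submodule.mem_orthogonal_singleton_iff_inner_left, hT, hTv, inner_smul_left,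
        Submodule.mem_orthogonal_singleton_iff_inner_right.1 hu, mul_zero]
    have hfact : Fact (Module.finrank ℂ E = n + 1) := ⟨hn⟩
    obtain ⟨b, m, hb, hm, hTb⟩ := ih (E := (ℂ ∙ v)ᗮ)
      (Submodule.finrank_orthogonal_span_singleton hv0) (T.restrict hinv)
      (fun u w => by
        simpa [LinearMap.restrict_apply] using hT u w)
    refine ⟨Matrix.vecCons v fun k => b k, Matrix.vecCons l m, ?_, ?_, ?_⟩
    · rw [orthonormal_vecCons_iff]
      refine ⟨hv, fun k => ?_, ?_⟩
      · exact Submodule.mem_orthogonal_singleton_iff_inner_right.1 (b k).2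
      · exact hb.comp_linearIsometry (Submodule.subtypeₗᵢ _)
    · intro k
      refine Fin.cases ?_ (fun k => ?_) k
      · simpa using hl
      · simpa using hm k
    · intro k
      refine Fin.cases ?_ (fun k => ?_) k
      · simpa using hTv
      · simpa [LinearMap.restrict_apply] using congrArg Subtype.val (hTb k)

end Takagi

/-- Takagi factorization: a complex symmetric matrix is diagonalized, with nonnegative diagonal, by
a unitary congruence. The columns of the unitary are the vectors scaled by the antilinear operator
`v ↦ conj (A v)`. -/
theorem exists_takagi {n : Type*} [Fintype n] [DecidableEq n] (A : Matrix n n ℂ) (hA : Aᵀ = A)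
    (d : ℕ) (hd : Fintype.card n = d) :
    ∃ (U : Matrix n (Fin d) ℂ) (l : Fin d → ℝ), U * Uᴴ = 1 ∧ (∀ k, 0 ≤ l k) ∧
      Uᵀ * A * U = diagonal fun k => (l k : ℂ) := by
  let T : EuclideanSpace ℂ n →ₗ⋆[ℂ] EuclideanSpace ℂ n :=
    { toFun := fun v => WithLp.toLp 2 (star (A *ᵥ v.ofLp))
      map_add' := fun u v => by
        ext i
        simp [mulVec_add]
      map_smul' := fun c v => by
        ext i
        simp [mulVec_smul] }
  have hinner : ∀ u v : EuclideanSpace ℂ n, inner ℂ (T u) v = u.ofLp ⬝ᵥ A *ᵥ v.ofLp := by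
    intro u v
    rw [EuclideanSpace.inner_eq_star_dotProduct]
    simp only [T, LinearMap.coe_mk, AddHom.coe_mk, star_star]
    rw [dotProduct_comm, ← hA, mulVec_transpose, dotProduct_mulVec, hA]
  obtain ⟨b, l, hb, hl, hT⟩ := exists_orthonormal_coneigenvectors d (by simpa using hd) T (by
    intro u v
    rw [hinner, hinner, dotProduct_mulVec, dotProduct_comm, ← mulVec_transpose, hA])
  let U : Matrix n (Fin d) ℂ := Matrix.of fun i k => b k i
  have hU : Uᴴ * U = 1 := by
    ext j k
    have := orthonormal_iff_ite.1 hb j k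
    rw [EuclideanSpace.inner_eq_star_dotProduct, dotProduct_comm] at this
    rw [Matrix.one_apply, ← this]
    rfl
  refine ⟨U, l, ?_, hl, ?_⟩
  · exact (Matrix.mul_eq_one_comm_of_card_eq _ _ _ (by simpa using hd.symm)).1 hU
  · ext j k
    have h1 : (Uᵀ * A * U) j k = inner ℂ (T (b j)) (b k) := by
      rw [hinner, Matrix.mul_assoc]
      simp [Matrix.mul_apply, dotProduct, mulVec, U]
    rw [h1, hT, inner_smul_left, orthonormal_iff_ite.1 hb, Matrix.diagonal_apply]
    simp

/-! ### The spin flip and the Wootters eigenvalues -/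

/-- The two-qubit spin flip form `ε ⊗ ε`, a real symmetric involution. -/
def flipForm : Matrix Ix Ix ℂ := eps ⊗ₖ eps

theorem flipForm_transpose : flipFormᵀ = flipForm := by
  ext ⟨i, j⟩ ⟨k, l⟩
  fin_cases i <;> fin_cases j <;> fin_cases k <;> fin_cases l <;> simp [flipForm, eps]

theorem flipForm_map_star : flipForm.map star = flipForm := by
  ext ⟨i, j⟩ ⟨k, l⟩
  fin_cases i <;> fin_cases j <;> fin_cases k <;> fin_cases l <;> simp [flipForm, eps]

theorem flipForm_conjTranspose : flipFormᴴ = flipForm := by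
  rw [conjTranspose, flipForm_transpose, flipForm_map_star]

theorem flipForm_mul_self : flipForm * flipForm = 1 := by
  have h : eps * eps = -1 := by
    ext i j
    fin_cases i <;> fin_cases j <;> simp [eps]
  rw [flipForm, ← mul_kronecker_mul, h]
  ext ⟨i, j⟩ ⟨k, l⟩
  fin_cases i <;> fin_cases j <;> fin_cases k <;> fin_cases l <;> simp

theorem map_star_mul {l m n : Type*} [Fintype m] (A : Matrix l m ℂ) (B : Matrix m n ℂ) :
    (A * B).map star = A.map star * B.map star := by
  ext i j
  simp [Matrix.mul_apply]

theorem map_star_map_star {m n : Type*} (A : Matrix m n ℂ) : (A.map star).map star = A := by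
  ext i j
  simp

theorem spinFlip_eq (M : Matrix Ix Ix ℂ) : spinFlip M = flipForm * M.map star * flipForm := by
  change (flipForm * M * flipFormᴴ).map star = _
  rw [map_star_mul, map_star_mul, flipForm_conjTranspose, flipForm_map_star]

theorem posSemidef_spinFlip {M : Matrix Ix Ix ℂ} (hM : M.PosSemidef) :
    (spinFlip M).PosSemidef := by
  have h := (hM.transpose).mul_mul_conjTranspose_same flipForm
  rwa [flipForm_conjTranspose, ← hM.isHermitian.eq, conjTranspose, transpose_map,
    transpose_transpose, ← spinFlip_eq] at h

theorem woottersMatrix_mul_self {M : Matrix Ix Ix ℂ} (hM : M.PosSemidef) :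
    woottersMatrix M * woottersMatrix M = CFC.sqrt M * spinFlip M * CFC.sqrt M := by
  refine CFC.sqrt_mul_sqrt_self _ ?_
  have hS := (Matrix.nonneg_iff_posSemidef.mp (CFC.sqrt_nonneg M)).isHermitian
  have h := (posSemidef_spinFlip hM).mul_mul_conjTranspose_same (CFC.sqrt M)
  rw [hS.eq] at h
  exact Matrix.nonneg_iff_posSemidef.mpr h

open Polynomial in
/-- The Wootters eigenvalues are the square roots of the roots of the characteristic polynomial of
`ρ ρ̃`. -/
theorem woottersEigenvalue_eq {M : Matrix Ix Ix ℂ} (hM : M.PosSemidef) {l : Fin 4 → ℝ}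
    (hl : Antitone l) (hl0 : ∀ k, 0 ≤ l k)
    (h : (M * spinFlip M).charpoly = ∏ k, (X - C (((l k) ^ 2 : ℝ) : ℂ))) :
    woottersEigenvalue M = l := by
  have hR := woottersMatrix_isHermitian M
  have hpos : (woottersMatrix M).PosSemidef :=
    Matrix.nonneg_iff_posSemidef.mp (CFC.sqrt_nonneg _)
  have hMnn : 0 ≤ M := Matrix.nonneg_iff_posSemidef.mpr hM
  have h1 : (woottersMatrix M * woottersMatrix M).charpoly = (M * spinFlip M).charpoly := by
    rw [woottersMatrix_mul_self hM, Matrix.charpoly_mul_comm, ← Matrix.mul_assoc,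
      CFC.sqrt_mul_sqrt_self M hMnn]
  have h2 : cfc (fun x : ℝ => x ^ 2) (woottersMatrix M)
      = woottersMatrix M * woottersMatrix M := by
    rw [← sq]
    exact cfc_pow_id (R := ℝ) (woottersMatrix M) 2 hR
  have h3 := hR.charpoly_cfc_eq (fun x : ℝ => x ^ 2)
  rw [h2, h1, h] at h3
  have hroots : ∀ {ι : Type} [Fintype ι] (f : ι → ℝ),
      (∏ i, (X - C ((f i : ℝ) : ℂ))).roots.map Complex.re = Finset.univ.val.map f := by
    intro ι _ f
    rw [Polynomial.roots_prod _ _ (Finset.prod_ne_zero_iff.2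
      fun i _ => Polynomial.X_sub_C_ne_zero _)]
    simp
  have h4 := congrArg (fun p : ℂ[X] => (p.roots.map Complex.re).map Real.sqrt) h3
  simp only [Complex.coe_algebraMap] at h4
  rw [hroots, hroots, Multiset.map_map, Multiset.map_map] at h4
  simp only [Function.comp_def, Real.sqrt_sq (hl0 _),
    Real.sqrt_sq (hpos.eigenvalues_nonneg _)] at h4
  have h5 := hR.sort_roots_charpoly_eq_eigenvalues₀
  rw [hR.charpoly_eq] at h5
  have h6 := hroots hR.eigenvalues
  have h7 : List.ofFn l = List.ofFn hR.eigenvalues₀ := by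
    rw [← h5]
    change _ = Multiset.sort (Multiset.map Complex.re _) _
    erw [h6]
    rw [← h4, Fin.univ_val_map, Multiset.coe_sort]
    symm
    apply List.mergeSort_of_pairwise
    simp_rw [decide_eq_true_eq, ← List.sortedGE_iff_pairwise]
    exact hl.sortedGE_ofFn
  rw [List.ofFn_congr (n := 4) (by simp) hR.eigenvalues₀] at h7
  exact (List.ofFn_injective h7).symm

/-- Every two-qubit state is a Gram matrix `G Gᴴ` of four vectors that are orthogonal for the spin
flip form, with nonnegative values on the diagonal. -/
theorem exists_flip_orthogonal {M : Matrix Ix Ix ℂ} (hM : M.PosSemidef) :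
    ∃ (G : Matrix Ix (Fin 4) ℂ) (l : Fin 4 → ℝ), Antitone l ∧ (∀ k, 0 ≤ l k) ∧ G * Gᴴ = M ∧
      Gᵀ * flipForm * G = diagonal fun k => (l k : ℂ) := by
  have hMnn : 0 ≤ M := Matrix.nonneg_iff_posSemidef.mpr hM
  set S := CFC.sqrt M with hS
  have hSh : Sᴴ = S := (Matrix.nonneg_iff_posSemidef.mp (CFC.sqrt_nonneg M)).isHermitian
  -- the columns of `S * U` are flip-orthogonal for the unitary `U` of a Takagi factorization
  obtain ⟨U, l, hU, hl, hD⟩ := exists_takagi (Sᵀ * flipForm * S) (by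
    simp [transpose_mul, flipForm_transpose, Matrix.mul_assoc]) 4 (by simp)
  -- `Tuple.sort` sorts increasingly, so it is applied to `-l`
  let σ := Tuple.sort fun k => -l k
  refine ⟨(S * U).submatrix id σ, l ∘ σ, ?_, fun k => hl _, ?_, ?_⟩
  · intro i j hij
    have := Tuple.monotone_sort (fun k => -l k) hij
    simpa using this
  · rw [conjTranspose_submatrix, submatrix_mul_equiv, conjTranspose_mul, hSh, submatrix_id_id,
      Matrix.mul_assoc, ← Matrix.mul_assoc U, hU, Matrix.one_mul, CFC.sqrt_mul_sqrt_self M hMnn]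
  · have h : ((S * U).submatrix id σ)ᵀ * flipForm * (S * U).submatrix id σ
        = (Uᵀ * (Sᵀ * flipForm * S) * U).submatrix σ σ := by
      rw [show Uᵀ * (Sᵀ * flipForm * S) * U = (S * U)ᵀ * flipForm * (S * U) by
        simp only [transpose_mul, Matrix.mul_assoc]]
      rfl
    rw [h, hD, submatrix_diagonal_equiv]
    rfl

theorem conjTranspose_mul_flipForm_mul {G : Matrix Ix (Fin 4) ℂ} {l : Fin 4 → ℝ}
    (hG : Gᵀ * flipForm * G = diagonal fun k => (l k : ℂ)) :
    Gᴴ * flipForm * G.map star = diagonal fun k => (l k : ℂ) := by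
  have h := congrArg (fun A => A.map star) hG
  simp only [map_star_mul, flipForm_map_star, Matrix.diagonal_map (star_zero ℂ)] at h
  simpa [conjTranspose, Function.comp_def] using h

open Polynomial in
theorem charpoly_mul_spinFlip {G : Matrix Ix (Fin 4) ℂ} {l : Fin 4 → ℝ}
    (hG : Gᵀ * flipForm * G = diagonal fun k => (l k : ℂ)) :
    (G * Gᴴ * spinFlip (G * Gᴴ)).charpoly = ∏ k, (X - C (((l k) ^ 2 : ℝ) : ℂ)) := by
  have hG' := conjTranspose_mul_flipForm_mul hG
  have h1 : G * Gᴴ * spinFlip (G * Gᴴ)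
      = G * (Gᴴ * flipForm * G.map star * Gᵀ * flipForm) := by
    have : (Gᴴ).map star = Gᵀ := by
      rw [conjTranspose, map_star_map_star]
    rw [spinFlip_eq, map_star_mul, this]
    simp only [Matrix.mul_assoc]
  have h2 : (Gᴴ * flipForm * G.map star * Gᵀ * flipForm) * G
      = diagonal fun k => (((l k) ^ 2 : ℝ) : ℂ) := by
    rw [Matrix.mul_assoc, Matrix.mul_assoc, ← Matrix.mul_assoc Gᵀ, hG, hG', diagonal_mul_diagonal]
    simp [sq]
  have h3 := Matrix.charpoly_mul_comm' G (Gᴴ * flipForm * G.map star * Gᵀ * flipForm)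
  rw [h2, charpoly_diagonal, ← h1] at h3
  exact mul_left_cancel₀ (pow_ne_zero 4 Polynomial.X_ne_zero) (by
    simpa only [Fintype.card_prod, Fintype.card_fin] using h3)

/-! ### The convex roof -/

/-- The quadratic form `fᵀ (ε ⊗ ε) f` of a two-qubit vector. Its modulus is the concurrence of the
pure state when `f` is normalized, and it scales with `‖f‖ ^ 2` in general. -/
def flipValue (f : Ix → ℂ) : ℂ := f ⬝ᵥ flipForm *ᵥ f

theorem flipValue_eq (f : Ix → ℂ) :
    flipValue f = 2 * (f (0, 0) * f (1, 1) - f (0, 1) * f (1, 0)) := by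
  simp [flipValue, flipForm, eps, dotProduct, mulVec, Fintype.sum_prod_type, Fin.sum_univ_two]
  ring

theorem flipValue_smul (c : ℂ) (f : Ix → ℂ) : flipValue (c • f) = c ^ 2 * flipValue f := by
  simp only [flipValue_eq, Pi.smul_apply, smul_eq_mul]
  ring

theorem flipValue_col {ι : Type*} (F : Matrix Ix ι ℂ) (j : ι) :
    flipValue (fun i => F i j) = (Fᵀ * flipForm * F) j j := by
  rw [Matrix.mul_assoc]
  simp [flipValue, Matrix.mul_apply, dotProduct, mulVec]

/-- By normalization `1 - tr π₁² = (‖φ‖²)² - tr π₁² = 2 |det φ|²`. -/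
theorem pureConcurrence_eq {φ : Vec2} (hφ : ‖φ‖ = 1) : pureConcurrence φ = ‖flipValue φ‖ := by
  have h1 : ‖φ‖ ^ 2 = 1 := by simp [hφ]
  rw [EuclideanSpace.norm_sq_eq] at h1
  simp only [Fintype.sum_prod_type, Fin.sum_univ_two, Complex.sq_norm, Complex.normSq_apply] at h1
  have h2 : 2 * (1 - (traceSnd (ketbra φ) * traceSnd (ketbra φ)).trace.re)
      = ‖flipValue φ‖ ^ 2 := by
    simp only [flipValue_eq, Complex.sq_norm, Complex.normSq_apply, traceSnd, ketbra, Matrix.trace,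
      Matrix.diag, Matrix.mul_apply, Fin.sum_univ_two, Complex.star_def, Complex.add_re,
      Complex.add_im, Complex.mul_re, Complex.mul_im, Complex.sub_re, Complex.sub_im,
      Complex.conj_re, Complex.conj_im, Complex.re_ofNat, Complex.im_ofNat]
    generalize (φ (0, 0)).re = a0 at *
    generalize (φ (0, 0)).im = a1 at *
    generalize (φ (0, 1)).re = b0 at *
    generalize (φ (0, 1)).im = b1 at *
    generalize (φ (1, 0)).re = c0 at *
    generalize (φ (1, 0)).im = c1 at *
    generalize (φ (1, 1)).re = d0 at *
    generalize (φ (1, 1)).im = d1 at *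
    linear_combination (-2) * (a0 * a0 + a1 * a1 + (b0 * b0 + b1 * b1) +
      (c0 * c0 + c1 * c1 + (d0 * d0 + d1 * d1)) + 1) * h1
  rw [pureConcurrence, h2, Real.sqrt_sq (norm_nonneg _)]

theorem range_mulVecLin_self_mul_conjTranspose {m n : Type*} [Fintype m] [Fintype n]
    (A : Matrix m n ℂ) : LinearMap.range (A * Aᴴ).mulVecLin = LinearMap.range A.mulVecLin := by
  refine Submodule.eq_of_le_of_finrank_eq ?_ (Matrix.rank_self_mul_conjTranspose A)
  rw [Matrix.mulVecLin_mul]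
  exact LinearMap.range_comp_le_range _ _

/-- Vectors whose Gram matrix `F Fᴴ` agrees with that of `G` are combinations of the columns
of `G`. -/
theorem exists_eq_mul_of_mul_conjTranspose_eq {m n ι : Type*} [Fintype m] [Fintype n] [Fintype ι]
    (F : Matrix m ι ℂ) (G : Matrix m n ℂ) (h : F * Fᴴ = G * Gᴴ) :
    ∃ C : Matrix n ι ℂ, F = G * C := by
  classical
  have hFG : LinearMap.range F.mulVecLin ≤ LinearMap.range G.mulVecLin := by
    rw [← range_mulVecLin_self_mul_conjTranspose F, h,
      range_mulVecLin_self_mul_conjTranspose G]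
  have hcol : ∀ j, ∃ c, G *ᵥ c = fun i => F i j := by
    intro j
    obtain ⟨c, hc⟩ := hFG ⟨Pi.single j 1, rfl⟩
    refine ⟨c, hc.trans ?_⟩
    rw [mulVecLin_apply, mulVec_single_one]
    rfl
  choose c hc using hcol
  refine ⟨Matrix.of fun k j => c j k, ?_⟩
  ext i j
  exact (congrFun (hc j) i).symm

/-- For a matrix `G` of flip-orthogonal columns every decomposition of `G Gᴴ` has
`fⱼᵀ (ε ⊗ ε) fⱼ = ∑ₖ λₖ Cₖⱼ²` with `∑ⱼ |Cₖⱼ|² = 1` whenever `λₖ ≠ 0`, so the triangle inequality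
bounds the total concurrence below. -/
theorem le_sum_norm_flipValue {ι : Type*} [Fintype ι] {G : Matrix Ix (Fin 4) ℂ} {l : Fin 4 → ℝ}
    (hl : ∀ k, 0 ≤ l k) (hG : Gᵀ * flipForm * G = diagonal fun k => (l k : ℂ))
    (F : Matrix Ix ι ℂ) (h : F * Fᴴ = G * Gᴴ) :
    l 0 - l 1 - l 2 - l 3 ≤ ∑ j, ‖flipValue fun i => F i j‖ := by
  obtain ⟨C, rfl⟩ := exists_eq_mul_of_mul_conjTranspose_eq F G h
  have hval : ∀ j, (flipValue fun i => (G * C) i j) = ∑ k, (l k : ℂ) * C k j ^ 2 := by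
    intro j
    rw [flipValue_col, transpose_mul, show Cᵀ * Gᵀ * flipForm * (G * C)
      = Cᵀ * (Gᵀ * flipForm * G * C) by simp only [Matrix.mul_assoc], hG]
    rw [Matrix.mul_apply]
    simp only [transpose_apply, diagonal_mul]
    exact Finset.sum_congr rfl fun k _ => by ring
  have hG' := conjTranspose_mul_flipForm_mul hG
  have hC : ∀ k, l k * ∑ j, ‖C k j‖ ^ 2 = l k := by
    intro k
    have h1 : diagonal (fun k => (l k : ℂ)) * (C * Cᴴ) * diagonal (fun k => (l k : ℂ))
        = diagonal (fun k => (l k : ℂ)) * diagonal (fun k => (l k : ℂ)) := by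
      nth_rewrite 1 3 [← hG]
      nth_rewrite 1 2 [← hG']
      calc _ = Gᵀ * flipForm * (G * C * (G * C)ᴴ) * flipForm * G.map star := by
            simp only [conjTranspose_mul, Matrix.mul_assoc]
        _ = _ := by
            rw [h]
            simp only [Matrix.mul_assoc]
    have h2 := congrFun (congrFun h1 k) k
    rw [diagonal_mul_diagonal, diagonal_apply_eq, mul_diagonal, diagonal_mul, Matrix.mul_apply]
      at h2
    simp only [conjTranspose_apply] at h2
    have h3 : ∑ j, C k j * star (C k j) = ((∑ j, ‖C k j‖ ^ 2 : ℝ) : ℂ) := by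
      push_cast
      exact Finset.sum_congr rfl fun j _ => by
        rw [Complex.star_def, Complex.mul_conj, Complex.normSq_eq_norm_sq]
        norm_cast
    rw [h3] at h2
    norm_cast at h2
    rcases eq_or_ne (l k) 0 with h0 | h0
    · simp [h0]
    · exact mul_right_cancel₀ h0 h2
  calc l 0 - l 1 - l 2 - l 3
      = ∑ j, (l 0 * ‖C 0 j‖ ^ 2 - l 1 * ‖C 1 j‖ ^ 2 - l 2 * ‖C 2 j‖ ^ 2 - l 3 * ‖C 3 j‖ ^ 2) := by
        simp only [Finset.sum_sub_distrib, ← Finset.mul_sum, hC]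
    _ ≤ ∑ j, ‖flipValue fun i => (G * C) i j‖ := by
        refine Finset.sum_le_sum fun j _ => ?_
        have hn : ∀ k, ‖(l k : ℂ) * C k j ^ 2‖ = l k * ‖C k j‖ ^ 2 := by
          intro k
          rw [norm_mul, norm_pow, Complex.norm_real, Real.norm_of_nonneg (hl k)]
        rw [hval, Fin.sum_univ_four, ← hn, ← hn, ← hn, ← hn]
        set a := (l 0 : ℂ) * C 0 j ^ 2
        set b := (l 1 : ℂ) * C 1 j ^ 2
        set c := (l 2 : ℂ) * C 2 j ^ 2
        set d := (l 3 : ℂ) * C 3 j ^ 2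
        have := norm_sub_le (a + b + c + d) d
        have := norm_sub_le (a + b + c) c
        have := norm_sub_le (a + b) b
        simp only [add_sub_cancel_right] at *
        linarith

/-- Four lengths, the first being the largest, close up to a polygon when the first is at most the
sum of the others; otherwise the best that phases achieve is to align the others against it. -/
theorem exists_phases {l : Fin 4 → ℝ} (hl : Antitone l) (hl0 : ∀ k, 0 ≤ l k) :
    ∃ u : Fin 4 → ℂ, (∀ k, ‖u k‖ = 1) ∧
      ‖∑ k, (l k : ℂ) * u k‖ = max 0 (l 0 - l 1 - l 2 - l 3) := by
  have h01 := hl (show (0 : Fin 4) ≤ 1 by decide)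
  have h12 := hl (show (1 : Fin 4) ≤ 2 by decide)
  have h23 := hl (show (2 : Fin 4) ≤ 3 by decide)
  have h0 := hl0 3
  rcases le_total 0 (l 0 - l 1 - l 2 - l 3) with h | h
  · refine ⟨![1, -1, -1, -1], ?_, ?_⟩
    · intro k
      fin_cases k <;> simp
    · rw [max_eq_right h, Fin.sum_univ_four, ← Real.norm_of_nonneg h, ← Complex.norm_real]
      congr 1
      simp
      ring
  · obtain ⟨t, ht⟩ : ∃ t : ℝ, ‖(l 0 : ℂ) + l 1 * Complex.exp (t * Complex.I)‖ = l 2 + l 3 := by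
      have hcont : Continuous fun t : ℝ => ‖(l 0 : ℂ) + l 1 * Complex.exp (t * Complex.I)‖ := by
        fun_prop
      refine mem_range_of_exists_le_of_exists_ge hcont ⟨Real.pi, ?_⟩ ⟨0, ?_⟩
      · rw [Complex.exp_pi_mul_I, show (l 0 : ℂ) + l 1 * -1 = ((l 0 - l 1 : ℝ) : ℂ) by
          push_cast; ring, Complex.norm_real, Real.norm_of_nonneg (by linarith)]
        linarith
      · rw [Complex.ofReal_zero, zero_mul, Complex.exp_zero,
          show (l 0 : ℂ) + l 1 * 1 = ((l 0 + l 1 : ℝ) : ℂ) by push_cast; ring, Complex.norm_real,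
          Real.norm_of_nonneg (by linarith)]
        linarith
    set c := (l 0 : ℂ) + l 1 * Complex.exp (t * Complex.I) with hc
    have hpol : c = (l 2 + l 3 : ℂ) * Complex.exp (c.arg * Complex.I) := by
      conv_lhs => rw [← Complex.norm_mul_exp_arg_mul_I c, ht]
      push_cast
      rfl
    refine ⟨![1, Complex.exp (t * Complex.I), -Complex.exp (c.arg * Complex.I),
      -Complex.exp (c.arg * Complex.I)], ?_, ?_⟩
    · intro k
      fin_cases k <;> simp [Complex.norm_exp_ofReal_mul_I]
    · rw [max_eq_left h, norm_eq_zero, Fin.sum_univ_four]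
      simp
      linear_combination hpol - hc

/-- A real Hadamard matrix of order four. -/
def hadamard : Matrix (Fin 4) (Fin 4) ℂ :=
  !![1, 1, 1, 1; 1, -1, 1, -1; 1, 1, -1, -1; 1, -1, -1, 1]

/-- A flip-orthogonal family, rephased and mixed by a Hadamard matrix, becomes a decomposition in
which all four vectors have the same flip value, namely a quarter of a sum of the `λₖ` with
arbitrary phases. -/
theorem exists_sum_norm_flipValue_eq {G : Matrix Ix (Fin 4) ℂ} {l : Fin 4 → ℝ} (hl : Antitone l)
    (hl0 : ∀ k, 0 ≤ l k) (hG : Gᵀ * flipForm * G = diagonal fun k => (l k : ℂ)) :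
    ∃ F : Matrix Ix (Fin 4) ℂ, F * Fᴴ = G * Gᴴ ∧
      ∑ j, ‖flipValue fun i => F i j‖ = max 0 (l 0 - l 1 - l 2 - l 3) := by
  obtain ⟨u, hu, hsum⟩ := exists_phases hl hl0
  -- flip values are quadratic, so the wanted phases enter through their square roots
  choose e he using fun k => IsAlgClosed.exists_pow_nat_eq (u k) (n := 2) (by norm_num)
  have hen : ∀ k, e k * star (e k) = 1 := by
    intro k
    have h1 : ‖e k‖ ^ 2 = 1 := by rw [← norm_pow, he, hu]
    rw [Complex.star_def, Complex.mul_conj, Complex.normSq_eq_norm_sq, h1, Complex.ofReal_one]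
  let D : Matrix (Fin 4) (Fin 4) ℂ := diagonal fun k => e k / 2
  have hH : D * (hadamard * hadamardᴴ) * Dᴴ = 1 := by
    have h1 : hadamard * hadamardᴴ = diagonal fun _ => 4 := by
      ext i j
      fin_cases i <;> fin_cases j <;>
        simp [hadamard, Matrix.mul_apply, Fin.sum_univ_four] <;> norm_num
    rw [h1]
    simp only [D, diagonal_conjTranspose, diagonal_mul_diagonal]
    rw [← diagonal_one]
    congr 1
    ext k
    simp only [Pi.star_apply, star_div₀, star_ofNat]
    linear_combination hen k
  refine ⟨G * (D * hadamard), ?_, ?_⟩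
  · calc _ = G * (D * (hadamard * hadamardᴴ) * Dᴴ) * Gᴴ := by
          simp only [conjTranspose_mul, Matrix.mul_assoc]
      _ = _ := by rw [hH, Matrix.mul_one]
  · have hval : ∀ j, (flipValue fun i => (G * (D * hadamard)) i j)
        = (∑ k, (l k : ℂ) * u k) / 4 := by
      intro j
      rw [flipValue_col, transpose_mul, transpose_mul, diagonal_transpose,
        show hadamardᵀ * D * Gᵀ * flipForm * (G * (D * hadamard))
          = hadamardᵀ * (D * (Gᵀ * flipForm * G) * D * hadamard) by
            simp only [Matrix.mul_assoc], hG]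
      rw [diagonal_mul_diagonal, diagonal_mul_diagonal, Matrix.mul_apply]
      simp only [diagonal_mul, transpose_apply, ← he, Finset.sum_div]
      refine Finset.sum_congr rfl fun k _ => ?_
      have : hadamard k j ^ 2 = 1 := by
        fin_cases k <;> fin_cases j <;> simp [hadamard]
      linear_combination (e k ^ 2 * l k / 4) * this
    simp only [hval, norm_div, hsum, Finset.sum_const, Finset.card_univ, Fintype.card_fin]
    simp
    ring

/-- Unnormalized decompositions `M = F Fᴴ` into finitely many columns yield average
concurrences. -/
theorem sum_norm_flipValue_mem {M : Matrix Ix Ix ℂ} (hM : M.trace = 1) {m : ℕ}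
    (F : Matrix Ix (Fin m) ℂ) (hF : F * Fᴴ = M) :
    ∑ j, ‖flipValue fun i => F i j‖ ∈ averageConcurrences M := by
  classical
  let f : Fin m → Vec2 := fun j => WithLp.toLp 2 fun i => F i j
  have hφ : ∀ j, ∃ φ : Vec2, ‖φ‖ = 1 ∧ f j = (‖f j‖ : ℂ) • φ := by
    intro j
    rcases eq_or_ne (f j) 0 with h | h
    · exact ⟨EuclideanSpace.single (0, 0) 1, by simp, by simp [h]⟩
    · refine ⟨((‖f j‖⁻¹ : ℝ) : ℂ) • f j, ?_, ?_⟩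
      · rw [norm_smul]
        simp [h]
      · rw [smul_smul]
        simp [h]
  choose φ hφ1 hφ2 using hφ
  have hF2 : ∀ j i, F i j = (‖f j‖ : ℂ) * φ j i := fun j i =>
    congrFun (congrArg WithLp.ofLp (hφ2 j)) i
  refine ⟨m, fun j => ‖f j‖ ^ 2, φ, fun j => by positivity, ?_, hφ1, ?_, ?_⟩
  · rw [← Complex.ofReal_inj, Complex.ofReal_one, ← hM, ← hF, Matrix.trace]
    simp only [Matrix.diag, Matrix.mul_apply, conjTranspose_apply]
    rw [Finset.sum_comm]
    push_cast
    refine Finset.sum_congr rfl fun j _ => ?_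
    rw [← Complex.ofReal_pow, EuclideanSpace.norm_sq_eq]
    push_cast
    refine Finset.sum_congr rfl fun i _ => ?_
    rw [Complex.star_def, Complex.mul_conj, Complex.normSq_eq_norm_sq]
    norm_cast
  · rw [← hF]
    ext i k
    simp only [Matrix.mul_apply, conjTranspose_apply, Matrix.sum_apply, Matrix.smul_apply, ketbra,
      smul_eq_mul]
    refine Finset.sum_congr rfl fun j _ => ?_
    rw [hF2, hF2]
    simp
    ring
  · refine Finset.sum_congr rfl fun j _ => ?_
    rw [pureConcurrence_eq (hφ1 j), show (fun i => F i j) = (‖f j‖ : ℂ) • (φ j).ofLp from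
      funext (hF2 j), flipValue_smul, norm_mul, norm_pow, Complex.norm_real, norm_norm]

/-- Pure state decompositions, absorbed into unnormalized columns. -/
theorem exists_eq_sum_norm_flipValue {M : Matrix Ix Ix ℂ} {c : ℝ}
    (hc : c ∈ averageConcurrences M) :
    ∃ (m : ℕ) (F : Matrix Ix (Fin m) ℂ), F * Fᴴ = M ∧ c = ∑ j, ‖flipValue fun i => F i j‖ := by
  obtain ⟨m, p, φ, hp, -, hφ, hM, hc⟩ := hc
  have hsq : ∀ j, ((√(p j) : ℝ) : ℂ) ^ 2 = p j := fun j => by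
    rw [← Complex.ofReal_pow, Real.sq_sqrt (hp j)]
  refine ⟨m, Matrix.of fun i j => (√(p j) : ℂ) * φ j i, ?_, ?_⟩
  · rw [hM]
    ext i k
    simp only [Matrix.mul_apply, conjTranspose_apply, Matrix.sum_apply, Matrix.smul_apply, ketbra,
      smul_eq_mul, Matrix.of_apply]
    refine Finset.sum_congr rfl fun j _ => ?_
    rw [← hsq]
    simp
    ring
  · rw [hc]
    refine Finset.sum_congr rfl fun j _ => ?_
    rw [pureConcurrence_eq (hφ j)]
    change _ = ‖flipValue ((√(p j) : ℂ) • (φ j).ofLp)‖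
    rw [flipValue_smul, hsq, norm_mul, Complex.norm_real, Real.norm_of_nonneg (hp j)]

/-- Wootters' theorem: the eigenvalue formula computes the convex roof of the pure state
concurrence. -/
theorem isLeast_woottersConcurrence {M : Matrix Ix Ix ℂ} (hM : IsDensity M) :
    IsLeast (averageConcurrences M) (woottersConcurrence M) := by
  obtain ⟨G, l, hl, hl0, rfl, hG⟩ := exists_flip_orthogonal hM.1
  have hw := woottersEigenvalue_eq hM.1 hl hl0 (charpoly_mul_spinFlip hG)
  rw [woottersConcurrence, hw]
  constructor
  · obtain ⟨F, hF, hsum⟩ := exists_sum_norm_flipValue_eq hl hl0 hG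
    rw [← hsum]
    exact sum_norm_flipValue_mem hM.2 F hF
  · intro c hc
    obtain ⟨m, F, hF, rfl⟩ := exists_eq_sum_norm_flipValue hc
    exact max_le (Finset.sum_nonneg fun j _ => norm_nonneg _) (le_sum_norm_flipValue hl0 hG F hF)

/-! ### Normal form of the antisymmetric vectors -/

/-- The traceless matrix `u₁ σ₁ - u₂ σ₂ + u₃ σ₃`, that is, the transpose of `u · σ` for the Pauli
matrices `σ`; the transpose is what makes `ε (u · σ)ᵀ` the symmetric matrix of parameter `u`. -/
def pauli (u : Fin 3 → ℂ) : Matrix (Fin 2) (Fin 2) ℂ :=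
  !![u 2, u 0 + Complex.I * u 1; u 0 - Complex.I * u 1, -u 2]

theorem pauli_mul_add_mul (u v : Fin 3 → ℂ) :
    pauli u * pauli v + pauli v * pauli u = (2 * (u ⬝ᵥ v)) • 1 := by
  ext i j
  fin_cases i <;> fin_cases j <;>
    simp [pauli, dotProduct, Fin.sum_univ_three] <;> ring_nf <;> simp [Complex.I_sq]

theorem pauli_ofReal_isHermitian (n : Fin 3 → ℝ) : (pauli fun i => (n i : ℂ)).IsHermitian := by
  ext i j
  fin_cases i <;> fin_cases j <;> simp [pauli]
  ring

/-- A nonzero real vector orthogonal to the real and imaginary parts of `u`. -/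
theorem exists_real_orthogonal (u : Fin 3 → ℂ) :
    ∃ n : Fin 3 → ℝ, n ≠ 0 ∧ (fun i => (n i : ℂ)) ⬝ᵥ u = 0 := by
  obtain ⟨n, hn, h⟩ := (Matrix.exists_mulVec_eq_zero_iff
    (M := !![(u 0).re, (u 1).re, (u 2).re; (u 0).im, (u 1).im, (u 2).im; 0, 0, 0])).2 (by
      simp [Matrix.det_fin_three])
  refine ⟨n, hn, ?_⟩
  have h0 := congrFun h 0
  have h1 := congrFun h 1
  simp [mulVec, dotProduct, Fin.sum_univ_three] at h0 h1
  apply Complex.ext <;> simp [dotProduct, Fin.sum_univ_three] <;> linarith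

/-- A unitary change of basis makes `pauli u` off-diagonal. For a real vector `n` orthogonal to the
real and imaginary parts of `u`, the matrix `pauli n` anticommutes with `pauli u` and has nonzero
eigenvalues, so `pauli u` has zero diagonal in its eigenbasis. -/
theorem exists_pauli_eq_offDiagonal (u : Fin 3 → ℂ) :
    ∃ (U : Matrix (Fin 2) (Fin 2) ℂ) (a b : ℂ), Uᴴ * U = 1 ∧ ‖b‖ ≤ ‖a‖ ∧
      pauli u = U * !![0, a; b, 0] * Uᴴ := by
  suffices h : ∃ (U : Matrix (Fin 2) (Fin 2) ℂ) (a b : ℂ), Uᴴ * U = 1 ∧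
      pauli u = U * !![0, a; b, 0] * Uᴴ by
    obtain ⟨U, a, b, hU, h⟩ := h
    rcases le_total ‖b‖ ‖a‖ with hab | hab
    · exact ⟨U, a, b, hU, hab, h⟩
    · have hX : (!![0, 1; 1, 0] : Matrix (Fin 2) (Fin 2) ℂ)ᴴ = !![0, 1; 1, 0] := by
        ext i j
        fin_cases i <;> fin_cases j <;> simp
      refine ⟨U * !![0, 1; 1, 0], b, a, ?_, hab, ?_⟩
      · rw [conjTranspose_mul, Matrix.mul_assoc, ← Matrix.mul_assoc Uᴴ, hU, Matrix.one_mul, hX]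
        simp [Matrix.one_fin_two]
      · rw [conjTranspose_mul, hX, h]
        calc _ = U * (!![0, 1; 1, 0] * !![0, b; a, 0] * !![0, 1; 1, 0]) * Uᴴ := by simp
          _ = _ := by simp only [Matrix.mul_assoc]
  obtain ⟨n, hn, hnu⟩ := exists_real_orthogonal u
  have hH := pauli_ofReal_isHermitian n
  set H := pauli fun i => (n i : ℂ) with hHdef
  let U : Matrix (Fin 2) (Fin 2) ℂ := hH.eigenvectorUnitary
  have hU1 : Uᴴ * U = 1 := Unitary.coe_star_mul_self hH.eigenvectorUnitary
  have hU2 : U * Uᴴ = 1 := Unitary.coe_mul_star_self hH.eigenvectorUnitary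
  let D : Matrix (Fin 2) (Fin 2) ℂ := diagonal fun i => (hH.eigenvalues i : ℂ)
  have hspec : H = U * D * Uᴴ := by
    have := hH.spectral_theorem
    rw [Unitary.conjStarAlgAut_apply] at this
    exact this
  let W := Uᴴ * pauli u * U
  have hanti : D * W + W * D = 0 := by
    have h1 := pauli_mul_add_mul (fun i => (n i : ℂ)) u
    rw [hnu, mul_zero, zero_smul, ← hHdef, hspec] at h1
    calc D * W + W * D = (Uᴴ * U) * D * W + W * D * (Uᴴ * U) := by
          rw [hU1, Matrix.one_mul, Matrix.mul_one]
      _ = Uᴴ * (U * D * Uᴴ * pauli u + pauli u * (U * D * Uᴴ)) * U := by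
          simp only [W, Matrix.mul_add, Matrix.add_mul, Matrix.mul_assoc]
      _ = 0 := by rw [h1, Matrix.mul_zero, Matrix.zero_mul]
  have hD : ∀ i, (hH.eigenvalues i : ℂ) ≠ 0 := by
    intro i hi
    have h1 := pauli_mul_add_mul (fun i => (n i : ℂ)) (fun i => (n i : ℂ))
    rw [← hHdef] at h1
    have h2 := congrArg (· *ᵥ (hH.eigenvectorBasis i).ofLp) h1
    simp only [Matrix.add_mulVec, ← Matrix.mulVec_mulVec, hH.mulVec_eigenvectorBasis,
      Complex.ofReal_eq_zero.1 hi, zero_smul, Matrix.mulVec_zero, add_zero, Matrix.smul_mulVec,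
      Matrix.one_mulVec] at h2
    rcases smul_eq_zero.1 h2.symm with h | h
    · apply hn
      have h3 : n ⬝ᵥ n = 0 := by
        rw [mul_eq_zero, or_iff_right two_ne_zero] at h
        rw [← Complex.ofReal_inj, Complex.ofReal_zero, ← h]
        simp [dotProduct]
      exact dotProduct_self_eq_zero.1 h3
    · have := hH.eigenvectorBasis.orthonormal.1 i
      rw [show hH.eigenvectorBasis i = 0 from by ext k; exact congrFun h k] at this
      simp at this
  have hdiag : ∀ i, W i i = 0 := by
    intro i
    have h1 := congrFun (congrFun hanti i) i
    simp only [D, Matrix.add_apply, diagonal_mul, mul_diagonal, Matrix.zero_apply] at h1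
    have h2 : (2 * (hH.eigenvalues i : ℂ)) * W i i = 0 := by linear_combination h1
    exact (mul_eq_zero.1 h2).resolve_left (mul_ne_zero two_ne_zero (hD i))
  refine ⟨U, W 0 1, W 1 0, hU1, ?_⟩
  have hW : !![0, W 0 1; W 1 0, 0] = W := by
    rw [← hdiag 0]
    nth_rewrite 2 [hdiag 0]
    rw [← hdiag 1]
    exact (Matrix.eta_fin_two W).symm
  rw [hW]
  calc pauli u = (U * Uᴴ) * pauli u * (U * Uᴴ) := by rw [hU2, Matrix.one_mul, Matrix.mul_one]
    _ = U * W * Uᴴ := by simp only [W, Matrix.mul_assoc]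

/-- Lagrange's identity for `w × w̄`. -/
theorem norm_crossVec_sq (u : EuclideanSpace ℂ (Fin 3)) :
    ‖crossVec u‖ ^ 2 = (‖u‖ ^ 2) ^ 2 - ‖bilinSq u‖ ^ 2 := by
  simp only [EuclideanSpace.norm_sq_eq, crossVec, bilinSq, Fin.sum_univ_three, Complex.sq_norm,
    Complex.normSq_apply]
  simp [crossProduct, sq]
  ring

theorem det_pauli (u : EuclideanSpace ℂ (Fin 3)) : (pauli u).det = -bilinSq u := by
  simp only [pauli, Matrix.det_fin_two_of, bilinSq, Fin.sum_univ_three]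
  linear_combination (u 1) ^ 2 * Complex.I_sq

theorem trace_pauli_mul_conjTranspose (u : EuclideanSpace ℂ (Fin 3)) :
    ((pauli u) * (pauli u)ᴴ).trace = ((2 * ‖u‖ ^ 2 : ℝ) : ℂ) := by
  rw [EuclideanSpace.norm_sq_eq]
  simp only [Fin.sum_univ_three, Complex.sq_norm, Complex.normSq_apply]
  simp only [pauli, Matrix.trace, Matrix.diag, Matrix.mul_apply, Fin.sum_univ_two,
    conjTranspose_apply]
  apply Complex.ext <;> simp <;> ring

/-- The off-diagonal entries of `pauli u` in the adapted basis, in terms of the invariants of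
`u`. -/
theorem exists_pauli_normalForm (u : EuclideanSpace ℂ (Fin 3)) :
    ∃ (U : Matrix (Fin 2) (Fin 2) ℂ) (a b : ℂ), Uᴴ * U = 1 ∧ pauli u = U * !![0, a; b, 0] * Uᴴ ∧
      a * b = bilinSq u ∧ ‖a‖ ^ 2 + ‖b‖ ^ 2 = 2 * ‖u‖ ^ 2 ∧
      ‖a‖ ^ 2 - ‖b‖ ^ 2 = 2 * ‖crossVec u‖ := by
  obtain ⟨U, a, b, hU, hab, h⟩ := exists_pauli_eq_offDiagonal u
  have hdet : a * b = bilinSq u := by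
    have h1 := det_pauli u
    rw [h, det_mul_comm, ← Matrix.mul_assoc, hU, Matrix.one_mul, Matrix.det_fin_two_of] at h1
    linear_combination -h1
  have htr : ‖a‖ ^ 2 + ‖b‖ ^ 2 = 2 * ‖u‖ ^ 2 := by
    have h1 := trace_pauli_mul_conjTranspose u
    have h2 : (U * !![0, a; b, 0] * Uᴴ) * (U * !![0, a; b, 0] * Uᴴ)ᴴ
        = U * (!![0, a; b, 0] * !![0, a; b, 0]ᴴ * Uᴴ) := by
      calc _ = U * (!![0, a; b, 0] * (Uᴴ * U) * !![0, a; b, 0]ᴴ * Uᴴ) := by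
            simp only [conjTranspose_mul, conjTranspose_conjTranspose, Matrix.mul_assoc]
        _ = _ := by rw [hU, Matrix.mul_one]
    rw [h, h2, trace_mul_comm, Matrix.mul_assoc, hU, Matrix.mul_one] at h1
    rw [← Complex.ofReal_inj, ← h1]
    simp only [Matrix.trace, Matrix.diag, Matrix.mul_apply, Fin.sum_univ_two, conjTranspose_apply]
    simp [Complex.mul_conj, Complex.normSq_eq_norm_sq]
  refine ⟨U, a, b, hU, h, hdet, htr, ?_⟩
  have h0 : 0 ≤ ‖a‖ ^ 2 - ‖b‖ ^ 2 := by
    have := norm_nonneg b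
    nlinarith
  rw [← sq_eq_sq₀ h0 (by positivity), mul_pow, norm_crossVec_sq, ← hdet, norm_mul]
  linear_combination (‖a‖ ^ 2 + ‖b‖ ^ 2 + 2 * ‖u‖ ^ 2) * htr

/-- The generator `(W ⊗ 1 + 1 ⊗ Z) / 2` attached to two one-qubit
matrices. -/
def halfSum (W Z : Matrix (Fin 2) (Fin 2) ℂ) : Matrix Ix Ix ℂ :=
  (1 / 2 : ℂ) • (W ⊗ₖ 1 + 1 ⊗ₖ Z)

theorem halfSum_conj {U V W Z : Matrix (Fin 2) (Fin 2) ℂ} (hU : U * Uᴴ = 1) (hV : V * Vᴴ = 1) :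
    halfSum (U * W * Uᴴ) (V * Z * Vᴴ) = (U ⊗ₖ V) * halfSum W Z * (U ⊗ₖ V)ᴴ := by
  rw [halfSum, halfSum, conjTranspose_kronecker, Matrix.mul_smul, Matrix.smul_mul, Matrix.mul_add,
    Matrix.add_mul, ← mul_kronecker_mul, ← mul_kronecker_mul, ← mul_kronecker_mul,
    ← mul_kronecker_mul, Matrix.mul_one, Matrix.mul_one, hU, hV]

/-- The four-qubit vector as a `4 × 4` matrix is the spin flip form times the generator. -/
theorem paramVec_eq (w z : EuclideanSpace ℂ (Fin 3)) (p q : Ix) :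
    paramVec w z (p, q) = (flipForm * halfSum (pauli w) (pauli z)) p q := by
  have h : ∀ u : EuclideanSpace ℂ (Fin 3), eps * pauli u = symMatrix u := by
    intro u
    ext i j
    fin_cases i <;> fin_cases j <;>
      simp [eps, pauli, symMatrix, Matrix.mul_apply, Fin.sum_univ_two]
    ring
  rw [halfSum, flipForm, Matrix.mul_smul, Matrix.mul_add, ← mul_kronecker_mul,
    ← mul_kronecker_mul, h, h, Matrix.mul_one]
  simp [paramVec]
  ring

theorem paramVec_antisymm (w z : EuclideanSpace ℂ (Fin 3)) : IsAntisymm (paramVec w z) := by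
  intro i j k l
  have heps : ∀ i k, eps k i = -eps i k := by
    intro i k
    fin_cases i <;> fin_cases k <;> simp [eps]
  have hsym : ∀ (u : EuclideanSpace ℂ (Fin 3)) i k, symMatrix u k i = symMatrix u i k := by
    intro u i k
    fin_cases i <;> fin_cases k <;> simp [symMatrix]
  simp only [paramVec]
  rw [heps i k, heps j l, hsym w i k, hsym z j l]
  ring

theorem reduced12_paramVec (w z : EuclideanSpace ℂ (Fin 3)) :
    reduced12 (paramVec w z) = flipForm * halfSum (pauli w) (pauli z) *
      (flipForm * halfSum (pauli w) (pauli z))ᴴ := by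
  ext p q
  simp only [reduced12, traceSnd, ketbra, paramVec_eq, Matrix.mul_apply (N := (_)ᴴ),
    conjTranspose_apply]

/-- With `ε ⊗ ε` split off, the vector is a generator `N`, and antisymmetry gives `ρ̃` the form
`(ε ⊗ ε) Nᴴ N (ε ⊗ ε)`, so that `ρ ρ̃` has the characteristic polynomial of `(N²)ᴴ N²`. -/
theorem charpoly_reduced12_mul_spinFlip (w z : EuclideanSpace ℂ (Fin 3)) :
    (reduced12 (paramVec w z) * spinFlip (reduced12 (paramVec w z))).charpoly =
      ((halfSum (pauli w) (pauli z) * halfSum (pauli w) (pauli z))ᴴ *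
        (halfSum (pauli w) (pauli z) * halfSum (pauli w) (pauli z))).charpoly := by
  have hanti : (flipForm * halfSum (pauli w) (pauli z))ᵀ
      = -(flipForm * halfSum (pauli w) (pauli z)) := by
    ext p q
    rw [transpose_apply, Matrix.neg_apply, ← paramVec_eq, ← paramVec_eq]
    exact paramVec_antisymm w z _ _ _ _
  rw [reduced12_paramVec]
  set N := halfSum (pauli w) (pauli z)
  have hstar : (flipForm * N).map star = -(flipForm * N)ᴴ := by
    rw [conjTranspose, hanti]
    ext p q
    simp
  have hstar' : ((flipForm * N)ᴴ).map star = -(flipForm * N) := by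
    rw [conjTranspose, map_star_map_star, hanti]
  have h1 : (flipForm * N * (flipForm * N)ᴴ).map star = Nᴴ * N := by
    rw [map_star_mul, hstar, hstar', Matrix.neg_mul, Matrix.mul_neg, neg_neg,
      conjTranspose_mul, flipForm_conjTranspose, Matrix.mul_assoc,
      ← Matrix.mul_assoc flipForm, flipForm_mul_self, Matrix.one_mul]
  rw [spinFlip_eq, h1, conjTranspose_mul, flipForm_conjTranspose]
  calc _ = (flipForm * (N * Nᴴ * (flipForm * flipForm) * Nᴴ * N * flipForm)).charpoly := by
        simp only [Matrix.mul_assoc]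
    _ = (N * (Nᴴ * Nᴴ * N)).charpoly := by
        rw [Matrix.charpoly_mul_comm, Matrix.mul_assoc _ flipForm flipForm, flipForm_mul_self,
          Matrix.mul_one, Matrix.mul_one]
        simp only [Matrix.mul_assoc]
    _ = _ := by
        rw [Matrix.charpoly_mul_comm, conjTranspose_mul]
        simp only [Matrix.mul_assoc]

theorem charpoly_conj_unitary {n : Type*} [Fintype n] [DecidableEq n] {U K : Matrix n n ℂ}
    (hU : Uᴴ * U = 1) :
    (((U * K * Uᴴ) * (U * K * Uᴴ))ᴴ * ((U * K * Uᴴ) * (U * K * Uᴴ))).charpoly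
      = ((K * K)ᴴ * (K * K)).charpoly := by
  have h : (U * K * Uᴴ) * (U * K * Uᴴ) = U * (K * K) * Uᴴ := by
    calc _ = U * K * (Uᴴ * U) * K * Uᴴ := by simp only [Matrix.mul_assoc]
      _ = _ := by rw [hU, Matrix.mul_one, Matrix.mul_assoc U]
  rw [h]
  calc _ = (U * ((K * K)ᴴ * (Uᴴ * U) * (K * K) * Uᴴ)).charpoly := by
        simp only [conjTranspose_mul, conjTranspose_conjTranspose, Matrix.mul_assoc]
    _ = _ := by
        rw [Matrix.charpoly_mul_comm, hU, Matrix.mul_one, Matrix.mul_assoc, hU, Matrix.mul_one]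

/-- The splitting of the two-qubit basis into `{00, 11}` and `{01, 10}`. -/
def parityEquiv : Ix ≃ Fin 2 ⊕ Fin 2 where
  toFun p := if p.1 = p.2 then Sum.inl p.1 else Sum.inr p.1
  invFun := Sum.elim (fun i => (i, i)) fun i => (i, i + 1)
  left_inv := by decide
  right_inv := by decide

open Polynomial in
theorem charpoly_conjTranspose_mul_self_fin_two (Q : Matrix (Fin 2) (Fin 2) ℂ) {s t : ℝ}
    (hst : s ^ 2 + t ^ 2 = ‖Q 0 0‖ ^ 2 + ‖Q 0 1‖ ^ 2 + ‖Q 1 0‖ ^ 2 + ‖Q 1 1‖ ^ 2)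
    (hdet : s * t = ‖Q.det‖) :
    (Qᴴ * Q).charpoly = (X - C ((s ^ 2 : ℝ) : ℂ)) * (X - C ((t ^ 2 : ℝ) : ℂ)) := by
  have h1 : (Qᴴ * Q).trace = ((s ^ 2 : ℝ) : ℂ) + ((t ^ 2 : ℝ) : ℂ) := by
    rw [← Complex.ofReal_add, hst]
    simp only [Matrix.trace, Matrix.diag, Matrix.mul_apply, Fin.sum_univ_two, conjTranspose_apply,
      Complex.star_def, Complex.conj_mul']
    push_cast
    ring
  have h2 : (Qᴴ * Q).det = ((s ^ 2 : ℝ) : ℂ) * ((t ^ 2 : ℝ) : ℂ) := by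
    rw [det_mul, det_conjTranspose, Complex.star_def, Complex.conj_mul', ← hdet]
    push_cast
    ring
  rw [Matrix.charpoly_fin_two, h1, h2, C_add, C_mul]
  ring

open Polynomial in
/-- In normal form `N²` is the direct sum of a block on `{00, 11}` and one on `{01, 10}`. -/
theorem charpoly_offDiagonal (a b c d : ℂ) {s₁ s₂ t₁ t₂ : ℝ}
    (hs : 16 * (s₁ ^ 2 + s₂ ^ 2) = 2 * ‖a * b + c * d‖ ^ 2 + 4 * (‖a‖ ^ 2 * ‖c‖ ^ 2)
      + 4 * (‖b‖ ^ 2 * ‖d‖ ^ 2))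
    (ht : 16 * (t₁ ^ 2 + t₂ ^ 2) = 2 * ‖a * b + c * d‖ ^ 2 + 4 * (‖a‖ ^ 2 * ‖d‖ ^ 2)
      + 4 * (‖b‖ ^ 2 * ‖c‖ ^ 2))
    (hs' : 16 * (s₁ * s₂) = ‖a * b - c * d‖ ^ 2) (ht' : 16 * (t₁ * t₂) = ‖a * b - c * d‖ ^ 2) :
    ((halfSum !![0, a; b, 0] !![0, c; d, 0] * halfSum !![0, a; b, 0] !![0, c; d, 0])ᴴ *
      (halfSum !![0, a; b, 0] !![0, c; d, 0] * halfSum !![0, a; b, 0] !![0, c; d, 0])).charpoly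
      = ∏ k, (X - C ((![s₁, t₁, t₂, s₂] k ^ 2 : ℝ) : ℂ)) := by
  set K := halfSum !![0, a; b, 0] !![0, c; d, 0] * halfSum !![0, a; b, 0] !![0, c; d, 0] with hK
  let Q₁ : Matrix (Fin 2) (Fin 2) ℂ :=
    !![(a * b + c * d) / 4, a * c / 2; b * d / 2, (a * b + c * d) / 4]
  let Q₂ : Matrix (Fin 2) (Fin 2) ℂ :=
    !![(a * b + c * d) / 4, a * d / 2; b * c / 2, (a * b + c * d) / 4]
  have hblock : reindex parityEquiv parityEquiv K = fromBlocks Q₁ 0 0 Q₂ := by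
    ext (i | i) (j | j) <;> fin_cases i <;> fin_cases j <;>
      simp [hK, parityEquiv, halfSum, Matrix.mul_apply, Fintype.sum_prod_type, Fin.sum_univ_two,
        Q₁, Q₂] <;> ring
  have hKK : reindex parityEquiv parityEquiv (Kᴴ * K)
      = fromBlocks (Q₁ᴴ * Q₁) 0 0 (Q₂ᴴ * Q₂) := by
    have h1 : reindex parityEquiv parityEquiv (Kᴴ * K)
        = (reindex parityEquiv parityEquiv K)ᴴ * reindex parityEquiv parityEquiv K := by
      simp [reindex_apply, conjTranspose_submatrix, submatrix_mul_equiv]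
    rw [h1, hblock, fromBlocks_conjTranspose, fromBlocks_multiply]
    simp
  have hd₁ : Q₁.det = (a * b - c * d) ^ 2 / 16 := by
    simp only [Q₁, det_fin_two_of]
    ring
  have hd₂ : Q₂.det = (a * b - c * d) ^ 2 / 16 := by
    simp only [Q₂, det_fin_two_of]
    ring
  rw [← charpoly_reindex parityEquiv, hKK, charpoly_fromBlocks_zero₂₁,
    charpoly_conjTranspose_mul_self_fin_two Q₁ (s := s₁) (t := s₂) ?_ ?_,
    charpoly_conjTranspose_mul_self_fin_two Q₂ (s := t₁) (t := t₂) ?_ ?_, Fin.prod_univ_four]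
  · simp only [Matrix.cons_val]
    ring
  · simp [Q₂]
    linarith
  · rw [hd₂]
    simp
    linarith
  · simp [Q₁]
    linarith
  · rw [hd₁]
    simp
    linarith

/-! ### The concurrence formula -/

/-- With `P² - D² = T² - Q²`, the numbers `(P ± D) / 2` enclose `(T ± Q) / 2`. -/
theorem antitone_nested {D P T Q : ℝ} (hQ : 0 ≤ Q) (hQT : Q ≤ T) (hTP : T ≤ P) (hQD : Q ≤ D)
    (hDP : D ≤ P) (h : P ^ 2 - D ^ 2 = T ^ 2 - Q ^ 2) :
    Antitone ![(P + D) / 2, (T + Q) / 2, (T - Q) / 2, (P - D) / 2] ∧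
      ∀ k, 0 ≤ ![(P + D) / 2, (T + Q) / 2, (T - Q) / 2, (P - D) / 2] k := by
  have h3 : P - D ≤ T - Q := by
    by_contra! hlt
    have h1 : (P - D) * (P + D - (T + Q)) + (P - D - (T - Q)) * (T + Q) = 0 := by
      linear_combination h
    have h2 : 0 ≤ (P - D - (T - Q)) * (T + Q) := mul_nonneg (by linarith) (by linarith)
    have h4 : 0 ≤ (P - D) * (P + D - (T + Q)) := mul_nonneg (by linarith) (by linarith)
    have h5 : (P - D) * (P + D - (T + Q)) = 0 := by linarith
    rcases mul_eq_zero.1 h5 with h6 | h6 <;> linarith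
  constructor
  · rw [Fin.antitone_iff_succ_le]
    intro i
    fin_cases i <;> simp <;> linarith
  · intro k
    fin_cases k <;> simp <;> linarith

/-- The Cauchy–Schwarz inequality, in the form that bounds `η²` by the normal form of the
radicands. -/
theorem norm_mul_sub_mul_sq_le (a b c d : ℂ) :
    ‖a * b - c * d‖ ^ 2 ≤ (‖a‖ ^ 2 + ‖d‖ ^ 2) * (‖b‖ ^ 2 + ‖c‖ ^ 2) := by
  have h : ‖a * b - c * d‖ ≤ ‖a‖ * ‖b‖ + ‖c‖ * ‖d‖ := by
    simpa using norm_sub_le (a * b) (c * d)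
  calc ‖a * b - c * d‖ ^ 2 ≤ (‖a‖ * ‖b‖ + ‖c‖ * ‖d‖) ^ 2 := by gcongr
    _ ≤ _ := by linarith [sq_nonneg (‖a‖ * ‖c‖ - ‖b‖ * ‖d‖)]

theorem norm_add_sq_add_norm_sub_sq (x y : ℂ) :
    ‖x + y‖ ^ 2 + ‖x - y‖ ^ 2 = 2 * (‖x‖ ^ 2 + ‖y‖ ^ 2) := by
  have := parallelogram_law_with_norm ℝ x y
  simpa only [sq] using this

/-- The normal form evaluates both radicands and, through the characteristic polynomial of
`ρ ρ̃`, the Wootters concurrence. -/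
theorem radicands_and_woottersConcurrence {w z : EuclideanSpace ℂ (Fin 3)}
    (h : ‖w‖ ^ 2 + ‖z‖ ^ 2 = 1) (hρ : (reduced12 (paramVec w z)).PosSemidef) :
    0 ≤ 1 - eta w z ^ 2 - gammaMinus w z ^ 2 ∧ 0 ≤ 1 - gammaPlus w z ^ 2 ∧
      woottersConcurrence (reduced12 (paramVec w z)) = concurrenceFormula w z := by
  obtain ⟨U, a, b, hU, hW, hab, hab1, hab2⟩ := exists_pauli_normalForm w
  obtain ⟨V, c, d, hV, hZ, hcd, hcd1, hcd2⟩ := exists_pauli_normalForm z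
  have hr := norm_nonneg (crossVec w)
  have hs := norm_nonneg (crossVec z)
  have heta : eta w z = ‖a * b - c * d‖ := by rw [eta, hab, hcd]
  have hpar := norm_add_sq_add_norm_sub_sq (a * b) (c * d)
  rw [norm_mul, norm_mul, ← heta] at hpar
  have hle₁ := norm_mul_sub_mul_sq_le a b c d
  have hle₂ := norm_mul_sub_mul_sq_le a b d c
  rw [← heta] at hle₁
  rw [mul_comm d c, ← heta] at hle₂
  set r := ‖crossVec w‖ with hrdef
  set s := ‖crossVec z‖ with hsdef
  set η := eta w z with hη
  -- the radicands, since `|a|² + |b|² + |c|² + |d|² = 2`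
  have hminus : 1 - gammaMinus w z ^ 2 = (‖a‖ ^ 2 + ‖d‖ ^ 2) * (‖b‖ ^ 2 + ‖c‖ ^ 2) := by
    have h1 : ‖a‖ ^ 2 + ‖d‖ ^ 2 = 1 + (r - s) := by linarith
    have h2 : ‖b‖ ^ 2 + ‖c‖ ^ 2 = 1 - (r - s) := by linarith
    rw [gammaMinus, h1, h2]
    ring
  have hplus : 1 - gammaPlus w z ^ 2 = (‖a‖ ^ 2 + ‖c‖ ^ 2) * (‖b‖ ^ 2 + ‖d‖ ^ 2) := by
    have h1 : ‖a‖ ^ 2 + ‖c‖ ^ 2 = 1 + (r + s) := by linarith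
    have h2 : ‖b‖ ^ 2 + ‖d‖ ^ 2 = 1 - (r + s) := by linarith
    rw [gammaPlus, h1, h2]
    ring
  have hX : 0 ≤ 1 - η ^ 2 - gammaMinus w z ^ 2 := by linarith
  have hY : 0 ≤ 1 - gammaPlus w z ^ 2 := by
    rw [hplus]
    positivity
  refine ⟨hX, hY, ?_⟩
  have hrs : (1 - η ^ 2 - gammaMinus w z ^ 2) + η ^ 2 - (1 - gammaPlus w z ^ 2) = 4 * (r * s) := by
    rw [gammaMinus, gammaPlus]
    ring
  have hrs0 : 0 ≤ r * s := mul_nonneg hr hs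
  -- `D` and `P` are the difference and the sum of the outer pair of eigenvalues, `Q` and `T` those
  -- of the inner pair; both pairs have the product `η² / 16`
  obtain ⟨D, hD0, hD, hDdef⟩ : ∃ D : ℝ, 0 ≤ D ∧ 4 * D ^ 2 = 1 - η ^ 2 - gammaMinus w z ^ 2 ∧
      √(1 - η ^ 2 - gammaMinus w z ^ 2) = 2 * D := by
    refine ⟨√(1 - η ^ 2 - gammaMinus w z ^ 2) / 2, by positivity, ?_, by ring⟩
    rw [div_pow, Real.sq_sqrt hX]
    ring
  obtain ⟨T, hT0, hT, hTdef⟩ : ∃ T : ℝ, 0 ≤ T ∧ 4 * T ^ 2 = 1 - gammaPlus w z ^ 2 ∧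
      √(1 - gammaPlus w z ^ 2) = 2 * T := by
    refine ⟨√(1 - gammaPlus w z ^ 2) / 2, by positivity, ?_, by ring⟩
    rw [div_pow, Real.sq_sqrt hY]
    ring
  obtain ⟨P, hP0, hP⟩ : ∃ P : ℝ, 0 ≤ P ∧ P ^ 2 = D ^ 2 + η ^ 2 / 4 :=
    ⟨_, Real.sqrt_nonneg _, Real.sq_sqrt (by positivity)⟩
  obtain ⟨Q, hQ0, hQ⟩ : ∃ Q : ℝ, 0 ≤ Q ∧ Q ^ 2 = T ^ 2 - η ^ 2 / 4 :=
    ⟨_, Real.sqrt_nonneg _, Real.sq_sqrt (by linarith)⟩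
  have hη2 : 0 ≤ η ^ 2 := sq_nonneg η
  obtain ⟨hanti, hnn⟩ := antitone_nested hQ0
    ((pow_le_pow_iff_left₀ hQ0 hT0 two_ne_zero).1 (by linarith))
    ((pow_le_pow_iff_left₀ hT0 hP0 two_ne_zero).1 (by linarith))
    ((pow_le_pow_iff_left₀ hQ0 hD0 two_ne_zero).1 (by linarith))
    ((pow_le_pow_iff_left₀ hD0 hP0 two_ne_zero).1 (by linarith))
    (show P ^ 2 - D ^ 2 = T ^ 2 - Q ^ 2 by linarith)
  have hchar := charpoly_reduced12_mul_spinFlip w z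
  have hUV : (U ⊗ₖ V)ᴴ * (U ⊗ₖ V) = 1 := by
    rw [conjTranspose_kronecker, ← mul_kronecker_mul, hU, hV, one_kronecker_one]
  rw [hW, hZ, halfSum_conj (mul_eq_one_comm.1 hU) (mul_eq_one_comm.1 hV),
    charpoly_conj_unitary hUV, charpoly_offDiagonal a b c d (s₁ := (P + D) / 2)
      (s₂ := (P - D) / 2) (t₁ := (T + Q) / 2) (t₂ := (T - Q) / 2) (by linarith) (by linarith)
      (by rw [← heta]; linarith) (by rw [← heta]; linarith)] at hchar
  rw [woottersConcurrence, woottersEigenvalue_eq hρ hanti hnn hchar, concurrenceFormula, ← hη,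
    hDdef, hTdef, mul_max_of_nonneg _ _ (by norm_num)]
  simp only [Matrix.cons_val]
  congr 1 <;> ring

/-! ### Separability -/

/-- Pure product states have vanishing flip value, so a separable state has a decomposition of
average concurrence zero. -/
theorem woottersConcurrence_eq_zero_of_isSeparable {M : Matrix Ix Ix ℂ} (hM : M.PosSemidef)
    (h : IsSeparable M) : woottersConcurrence M = 0 := by
  obtain ⟨m, p, a, b, hp, -, ha, hb, hMab⟩ := h
  have hfac : ∀ {A : Matrix (Fin 2) (Fin 2) ℂ}, IsDensity A →
      ∃ R : Matrix (Fin 2) (Fin 2) ℂ, A = R * Rᴴ := by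
    intro A hA
    obtain ⟨B, hB⟩ := CStarAlgebra.nonneg_iff_eq_mul_star_self.1 hA.1.nonneg
    exact ⟨B, hB⟩
  choose R hR using fun j => hfac (ha j)
  choose S hS using fun j => hfac (hb j)
  obtain ⟨G, l, hl, hl0, hGM, hG⟩ := exists_flip_orthogonal hM
  have hw := woottersEigenvalue_eq hM hl hl0 (by
    rw [← hGM]
    exact charpoly_mul_spinFlip hG)
  -- the columns of `F` are the products of a column of `R j` and a column of `S j`,
  -- scaled by `√(p j)`
  let F : Matrix Ix (Fin m × Fin 2 × Fin 2) ℂ :=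
    Matrix.of fun i j => (√(p j.1) : ℂ) * (R j.1 i.1 j.2.1 * S j.1 i.2 j.2.2)
  have hF : F * Fᴴ = G * Gᴴ := by
    rw [hGM, hMab]
    ext i k
    have hsq : ∀ j, ((√(p j) : ℝ) : ℂ) * (√(p j) : ℝ) = p j := fun j => by
      rw [← Complex.ofReal_mul, Real.mul_self_sqrt (hp j)]
    simp only [F, Matrix.mul_apply, conjTranspose_apply, Matrix.sum_apply, Matrix.smul_apply,
      smul_eq_mul, Matrix.of_apply, kroneckerMap_apply, Fintype.sum_prod_type, Fin.sum_univ_two,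
      hR, hS, star_mul', ← hsq, Complex.star_def, Complex.conj_ofReal]
    exact Finset.sum_congr rfl fun j _ => by ring
  have hle := le_sum_norm_flipValue hl0 hG F hF
  have hzero : ∀ j, (flipValue fun i => F i j) = 0 := by
    intro j
    rw [flipValue_eq]
    simp only [F, Matrix.of_apply]
    ring
  simp only [hzero, norm_zero, Finset.sum_const_zero] at hle
  rw [woottersConcurrence, hw, max_eq_left hle]

/-- The reduced density matrices of a normalized vector. -/
theorem isDensity_traceSnd_ketbra {m n : Type*} [Fintype m] [Fintype n]
    {φ : EuclideanSpace ℂ (m × n)} (hφ : ‖φ‖ = 1) : IsDensity (traceSnd (ketbra φ)) := by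
  constructor
  · have h : traceSnd (ketbra φ) = (Matrix.of fun i t => φ (i, t)) *
        (Matrix.of fun i t => φ (i, t))ᴴ := by
      ext i k
      simp [traceSnd, ketbra, Matrix.mul_apply]
    rw [h]
    exact posSemidef_self_mul_conjTranspose _
  · have h : ‖φ‖ ^ 2 = 1 := by simp [hφ]
    rw [← Complex.ofReal_one, ← h, EuclideanSpace.norm_sq_eq, Fintype.sum_prod_type]
    simp only [Matrix.trace, Matrix.diag, traceSnd, ketbra, Complex.star_def, Complex.mul_conj']
    push_cast
    rfl

/-- The two qubits of a state vector, exchanged. -/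
def swapQubits (φ : Vec2) : Vec2 := WithLp.toLp 2 fun i => φ (i.2, i.1)

theorem norm_swapQubits (φ : Vec2) : ‖swapQubits φ‖ = ‖φ‖ := by
  simp only [EuclideanSpace.norm_eq, swapQubits, Fintype.sum_prod_type, Fin.sum_univ_two]
  congr 1
  ring

/-- A normalized vector with vanishing flip value is the product of its marginals. -/
theorem ketbra_eq_kronecker {φ : Vec2} (hφ : ‖φ‖ = 1) (h : flipValue φ = 0) :
    ketbra φ = traceSnd (ketbra φ) ⊗ₖ traceSnd (ketbra (swapQubits φ)) := by
  have hswap : ∀ i j t u : Fin 2, φ (i, t) * φ (u, j) = φ (i, j) * φ (u, t) := by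
    rw [flipValue_eq] at h
    intro i j t u
    fin_cases i <;> fin_cases j <;> fin_cases t <;> fin_cases u <;> simp <;>
      first
        | ring1
        | linear_combination h / 2
        | linear_combination -h / 2
  have htr : (traceSnd (ketbra φ)).trace = 1 := (isDensity_traceSnd_ketbra hφ).2
  ext ⟨i, j⟩ ⟨k, l⟩
  have hstar : ∀ t u : Fin 2,
      star (φ (k, t)) * star (φ (u, l)) = star (φ (k, l)) * star (φ (u, t)) :=
    fun t u => by rw [← star_mul', hswap, star_mul']
  simp only [Matrix.trace, Matrix.diag, traceSnd, ketbra, swapQubits, kroneckerMap_apply] at htr ⊢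
  rw [Finset.sum_comm] at htr
  rw [Finset.sum_mul_sum, ← mul_one (φ (i, j) * star (φ (k, l))), ← htr, Finset.mul_sum]
  refine Finset.sum_congr rfl fun t _ => ?_
  rw [Finset.mul_sum]
  refine Finset.sum_congr rfl fun u _ => ?_
  linear_combination (-star (φ (k, t)) * star (φ (u, l))) * hswap i j t u -
    φ (i, j) * φ (u, t) * hstar t u

theorem isSeparable_iff {M : Matrix Ix Ix ℂ} (hM : IsDensity M) :
    IsSeparable M ↔ woottersConcurrence M = 0 := by
  refine ⟨woottersConcurrence_eq_zero_of_isSeparable hM.1, fun h => ?_⟩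
  have hmem := (isLeast_woottersConcurrence hM).1
  rw [h] at hmem
  obtain ⟨m, p, φ, hp, hp1, hφ, hMφ, hsum⟩ := hmem
  refine ⟨m, p, fun j => traceSnd (ketbra (φ j)), fun j => traceSnd (ketbra (swapQubits (φ j))), hp,
    hp1, fun j => isDensity_traceSnd_ketbra (hφ j),
    fun j => isDensity_traceSnd_ketbra (by rw [norm_swapQubits, hφ]), ?_⟩
  have hz : ∀ j ∈ Finset.univ, p j * pureConcurrence (φ j) = 0 :=
    (Finset.sum_eq_zero_iff_of_nonneg fun j _ => mul_nonneg (hp j) (Real.sqrt_nonneg _)).1 hsum.symm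
  rw [hMφ]
  refine Finset.sum_congr rfl fun j _ => ?_
  rcases mul_eq_zero.1 (hz j (Finset.mem_univ j)) with h0 | h0
  · simp [h0]
  · rw [← ketbra_eq_kronecker (hφ j)]
    rwa [pureConcurrence_eq (hφ j), norm_eq_zero] at h0

theorem concurrenceFormula_eq_zero_iff {w z : EuclideanSpace ℂ (Fin 3)}
    (h : 0 ≤ 1 - gammaPlus w z ^ 2) :
    concurrenceFormula w z = 0 ↔ 4 * ‖crossVec w‖ * ‖crossVec z‖ ≤ eta w z ^ 2 := by
  rw [concurrenceFormula, mul_eq_zero, or_iff_right (by norm_num), max_eq_left_iff, sub_nonpos,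
    Real.sqrt_le_sqrt_iff h, gammaMinus, gammaPlus]
  constructor <;> intro h <;> linarith

/-! ### The parametrization -/

theorem norm_paramVec_sq (w z : EuclideanSpace ℂ (Fin 3)) :
    ‖paramVec w z‖ ^ 2 = ‖w‖ ^ 2 + ‖z‖ ^ 2 := by
  simp only [EuclideanSpace.norm_sq_eq, Fintype.sum_prod_type, Fin.sum_univ_two,
    Fin.sum_univ_three, paramVec, Complex.sq_norm, Complex.normSq_apply]
  simp [eps, symMatrix]
  ring

/-- The parameters of an antisymmetric vector, solved from its six independent amplitudes. -/
theorem eq_paramVec_iff {ψ : Vec4} (hψ : IsAntisymm ψ) (w z : EuclideanSpace ℂ (Fin 3)) :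
    ψ = paramVec w z ↔
      w = !₂[ψ ((0, 0), (0, 1)) - ψ ((1, 0), (1, 1)),
        Complex.I * (ψ ((0, 0), (0, 1)) + ψ ((1, 0), (1, 1))),
        ψ ((0, 1), (1, 0)) - ψ ((0, 0), (1, 1))] ∧
      z = !₂[ψ ((0, 0), (1, 0)) - ψ ((0, 1), (1, 1)),
        Complex.I * (ψ ((0, 0), (1, 0)) + ψ ((0, 1), (1, 1))),
        -(ψ ((0, 0), (1, 1)) + ψ ((0, 1), (1, 0)))] := by
  constructor
  · rintro rfl
    constructor
    · ext i
      fin_cases i <;> simp [paramVec, eps, symMatrix] <;> ring_nf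
      simp
    · ext i
      fin_cases i <;> simp [paramVec, eps, symMatrix] <;> ring_nf
      simp
  · rintro ⟨rfl, rfl⟩
    have hdiag : ∀ p : Ix, ψ (p, p) = 0 := fun p => by
      linear_combination hψ p.1 p.2 p.1 p.2 / 2
    ext ⟨⟨i, j⟩, ⟨k, l⟩⟩
    fin_cases i <;> fin_cases j <;> fin_cases k <;> fin_cases l <;>
      simp [paramVec, eps, symMatrix, hdiag, hψ 0 1 0 0, hψ 1 0 0 0, hψ 1 1 0 0, hψ 1 0 0 1,
        hψ 1 1 0 1, hψ 1 1 1 0] <;> ring_nf <;> simp <;> ring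

theorem existsUnique_paramVec {ψ : Vec4} (hψ : IsAntisymm ψ) (h1 : ‖ψ‖ = 1) :
    ∃! p : EuclideanSpace ℂ (Fin 3) × EuclideanSpace ℂ (Fin 3),
      ‖p.1‖ ^ 2 + ‖p.2‖ ^ 2 = 1 ∧ ψ = paramVec p.1 p.2 := by
  refine ⟨⟨_, _⟩, ⟨?_, (eq_paramVec_iff hψ _ _).2 ⟨rfl, rfl⟩⟩, fun q hq => ?_⟩
  · rw [← norm_paramVec_sq, ← (eq_paramVec_iff hψ _ _).2 ⟨rfl, rfl⟩, h1, one_pow]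
  · exact Prod.ext_iff.2 ((eq_paramVec_iff hψ _ _).1 hq.2)

end TwoQubit

end

theorem mainTheorem6 :
    -- the normalized antisymmetric vectors are exactly the `paramVec w z` with unit parameters
    (∀ ψ : TwoQubit.Vec4, TwoQubit.IsAntisymm ψ ∧ ‖ψ‖ = 1 →
      ∃! p : EuclideanSpace ℂ (Fin 3) × EuclideanSpace ℂ (Fin 3),
        ‖p.1‖ ^ 2 + ‖p.2‖ ^ 2 = 1 ∧ ψ = TwoQubit.paramVec p.1 p.2) ∧
    ∀ w z : EuclideanSpace ℂ (Fin 3), ‖w‖ ^ 2 + ‖z‖ ^ 2 = 1 →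
      TwoQubit.IsAntisymm (TwoQubit.paramVec w z) ∧ ‖TwoQubit.paramVec w z‖ = 1 ∧
      -- the radicands are nonnegative
      0 ≤ 1 - TwoQubit.eta w z ^ 2 - TwoQubit.gammaMinus w z ^ 2 ∧
      0 ≤ 1 - TwoQubit.gammaPlus w z ^ 2 ∧
      -- the Wootters concurrence, by its eigenvalue formula and as the convex roof minimum
      TwoQubit.woottersConcurrence (TwoQubit.reduced12 (TwoQubit.paramVec w z)) =
        TwoQubit.concurrenceFormula w z ∧
      IsLeast (TwoQubit.averageConcurrences (TwoQubit.reduced12 (TwoQubit.paramVec w z)))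
        (TwoQubit.concurrenceFormula w z) ∧
      -- separability
      (TwoQubit.IsSeparable (TwoQubit.reduced12 (TwoQubit.paramVec w z)) ↔
        4 * ‖TwoQubit.crossVec w‖ * ‖TwoQubit.crossVec z‖ ≤ TwoQubit.eta w z ^ 2) := by
  refine ⟨fun ψ hψ => TwoQubit.existsUnique_paramVec hψ.1 hψ.2, fun w z h => ?_⟩
  have hnorm : ‖TwoQubit.paramVec w z‖ = 1 := by
    rw [← sq_eq_sq₀ (norm_nonneg _) zero_le_one, TwoQubit.norm_paramVec_sq, h, one_pow]
  have hρ : TwoQubit.IsDensity (TwoQubit.reduced12 (TwoQubit.paramVec w z)) :=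
    TwoQubit.isDensity_traceSnd_ketbra hnorm
  obtain ⟨h1, h2, h3⟩ := TwoQubit.radicands_and_woottersConcurrence h hρ.1
  refine ⟨TwoQubit.paramVec_antisymm w z, hnorm, h1, h2, h3, ?_, ?_⟩
  · rw [← h3]
    exact TwoQubit.isLeast_woottersConcurrence hρ
  · rw [TwoQubit.isSeparable_iff hρ, h3, TwoQubit.concurrenceFormula_eq_zero_iff h2]
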